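/- Let $\mathbb F_q$ be a finite field with algebraic closure $\overline{\mathbb F}_q$. An affine variety $X\subset\overline{\mathbb F}_q^{\,n}$ is the common zero set of finitely many polynomials; $I(X)\subset\overline{\mathbb F}_q[x_1,\dots,x_n]$ is the ideal of all polynomials vanishing on $X$, and $X$ is defined over $\mathbb F_q$ if $I(X)$ is generated by polynomials with coefficients in $\mathbb F_q$. For a point $a\in\overline{\mathbb F}_q^{\,n}$ let $\delta(a)\ge 1$ be the least integer with $a\in\mathbb F_{q^{\delta(a)}}^{\,n}$. For a field $\mathbb F_q\subseteq F\subseteq\overline{\mathbb F}_q$ and a point $a\in X\cap F^n$ the Zariski tangent space is $$T_a(X,F)=\Big\{v\in F^n \;\Big|\; \sum_{j=1}^n v_j\frac{\partial f}{\partial x_j}(a)=0\ \text{ for all } f\in I(X)\Big\}.$$ The smooth locus $X^{\rm smooth}$ is the set of all $a\in X$ with $\dim T_a(X,\mathbb F_{q^{\delta(a)}})=\dim X$. (i) Let $X\subset\overline{\mathbb F}_q^{\,n}$ be an irreducible affine variety defined over $\mathbb F_q$ and let $\varphi_{n+1}(x_1,\dots,x_n)=(x_1,\dots,x_n,-\sum_{i=1}^n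 x_i)$. Then for all $a\in X^{\rm smooth}$ $$\varphi_{n+1}T_a(X,\mathbb F_{q^{\delta(a)}})=T_{\varphi_{n+1}(a)}(\varphi_{n+1}(X),\mathbb F_{q^{\delta(a)}}).$$ (ii) Let $X\subset\overline{\mathbb F}_q^{\,n}$ and $Y\subset\overline{\mathbb F}_q^{\,m}$ be irreducible affine varieties defined over $\mathbb F_q$. Then for all $(a,b)\in X^{\rm smooth}\times Y^{\rm smooth}$ $$T_a(X,\mathbb F_{q^{\delta(a,b)}})\oplus T_b(Y,\mathbb F_{q^{\delta(a,b)}})=T_{(a,b)}(X\times Y,\mathbb F_{q^{\delta(a,b)}}),$$ where $C_1\oplus C_2=\{(v,w)\mid v\in C_1,\ w\in C_2\}$. (iii) Let $X\subset\overline{\mathbb F}_q^{\,n}$ be an irreducible affine variety defined over $\mathbb F_q$, let $g=(g_1,\dots,g_s):\overline{\mathbb F}_q^{\,n}\to\overline{\mathbb F}_q^{\,s}$ with $g_1,\dots,g_s\in\mathbb F_q[x_1,\dots,x_n]$, and let $a\in X^{\rm smooth}$ be a point such that the fibre $Y_a=g^{-1}(g(a))$ through $a$ is irreducible, defined over $\mathbb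 F_q$, a complete intersection (that is, $I(Y_a)$ is generated by $g_1-g_1(a),\dots,g_s-g_s(a)$ and $\dim Y_a=n-s$), and $a\in Y_a^{\rm smooth}$. Then $$\big(T_a(X,\mathbb F_{q^{\delta(a)}})\ \big|\ T_a(X,\mathbb F_{q^{\delta(a)}})+T_a(Y_a,\mathbb F_{q^{\delta(a)}})\big)=T_{(a,a)}\big(X\times_{g(X)}\overline{\mathbb F}_q^{\,n},\mathbb F_{q^{\delta(a)}}\big),$$ where $(C_1\,|\,C_1+C_2)=\{(u,u+v)\mid u\in C_1,\ v\in C_2\}$ and $X\times_{g(X)}\overline{\mathbb F}_q^{\,n}=\{(x,y)\in X\times\overline{\mathbb F}_q^{\,n}\mid g(x)=g(y)\}$. -/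

import Mathlib

namespace TangentCodes

/-- The field with `q ^ m` elements inside an algebraic closure `K` of the field `k` with `q`
elements: the set of the solutions of `x ^ (q ^ m) = x` (for `m ≥ 1`). -/
def finiteSubfield (k K : Type*) [Field k] [Fintype k] [Field K] [Algebra k K] (m : ℕ) :
    IntermediateField k K where
  carrier := {x | x ^ (Fintype.card k ^ m) = x}
  mul_mem' {x y} hx hy := by
    simp only [Set.mem_ofPred_eq] at hx hy ⊢
    rw [mul_pow, hx, hy]
  add_mem' {x y} hx hy := by
    simp only [Set.mem_ofPred_eq] at hx hy ⊢
    have h : ∀ z : K, (FiniteField.frobeniusAlgHom k K ^ m) z = z ^ (Fintype.card k ^ m) := by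
      intro z
      rw [AlgHom.coe_pow, FiniteField.coe_frobeniusAlgHom, pow_iterate]
    rw [← h, map_add, h, h, hx, hy]
  algebraMap_mem' r := by
    simp only [Set.mem_ofPred_eq]
    rw [← map_pow, FiniteField.pow_card_pow]
  inv_mem' x hx := by
    simp only [Set.mem_ofPred_eq] at hx ⊢
    rw [inv_pow, hx]

/-- `δ(a)`: the least `m ≥ 1` such that all coordinates of `a` lie in the field with `q ^ m`
elements. -/
noncomputable def pointDegree (k : Type*) {K : Type*} [Field k] [Fintype k] [Field K]
    [Algebra k K] {n : ℕ} (a : Fin n → K) : ℕ :=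
  sInf {m : ℕ | 0 < m ∧ ∀ i, a i ∈ finiteSubfield k K m}

/-- The definition field of the point `a`: the field with `q ^ δ(a)` elements. -/
noncomputable def definitionField (k : Type*) {K : Type*} [Field k] [Fintype k] [Field K]
    [Algebra k K] {n : ℕ} (a : Fin n → K) : IntermediateField k K :=
  finiteSubfield k K (pointDegree k a)

/-- An affine variety: the common zero set of finitely many polynomials. -/
def IsAffineVariety {K : Type*} [Field K] {n : ℕ} (X : Set (Fin n → K)) : Prop :=
  ∃ (m : ℕ) (f : Fin m → MvPolynomial (Fin n) K),
    X = {a | ∀ i, MvPolynomial.eval a (f i) = 0}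

/-- An irreducible affine variety: it is non-empty, and it is not the union of two proper affine
subvarieties. -/
def IsIrreducibleVariety {K : Type*} [Field K] {n : ℕ} (X : Set (Fin n → K)) : Prop :=
  IsAffineVariety X ∧ X.Nonempty ∧
    ∀ Z₁ Z₂ : Set (Fin n → K), IsAffineVariety Z₁ → IsAffineVariety Z₂ → X = Z₁ ∪ Z₂ →
      Z₁ = X ∨ Z₂ = X

/-- `X` is defined over `k`: the absolute ideal of `X` is generated by finitely many polynomials
with coefficients in `k`. -/
def IsDefinedOver (k : Type*) {K : Type*} [Field k] [Field K] [Algebra k K] {n : ℕ}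
    (X : Set (Fin n → K)) : Prop :=
  ∃ (m : ℕ) (f : Fin m → MvPolynomial (Fin n) k),
    MvPolynomial.vanishingIdeal K X =
      Ideal.span (Set.range fun i => MvPolynomial.map (algebraMap k K) (f i))

/-- The dimension of `X`: the Krull dimension of its affine coordinate ring. -/
noncomputable def varietyDim {K : Type*} [Field K] {n : ℕ} (X : Set (Fin n → K)) : WithBot ℕ∞ :=
  ringKrullDim (MvPolynomial (Fin n) K ⧸ MvPolynomial.vanishingIdeal K X)

/-- The Zariski tangent space `T_a(X, F) ⊆ F ^ n`: the words `v` with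
`∑ j, v j * (∂ f / ∂ x j) (a) = 0` for all `f` in the absolute ideal of `X`. By
`mem_tangentSpace_iff` it is the code over `F` whose parity check matrix is the Jacobian matrix
at `a` of any generators of the absolute ideal. -/
def tangentSpace {k K : Type*} [Field k] [Field K] [Algebra k K] {n : ℕ}
    (F : IntermediateField k K) (X : Set (Fin n → K)) (a : Fin n → K) :
    Submodule F (Fin n → F) where
  carrier := {v | ∀ f ∈ MvPolynomial.vanishingIdeal K X,
    ∑ j, (v j : K) * MvPolynomial.eval a (MvPolynomial.pderiv j f) = 0}
  zero_mem' f _ := by simp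
  add_mem' {v w} hv hw f hf := by
    have h := congrArg₂ (· + ·) (hv f hf) (hw f hf)
    simpa [add_mul, Finset.sum_add_distrib] using h
  smul_mem' c v hv f hf := by
    have h := congrArg ((c : K) * ·) (hv f hf)
    simpa [Finset.mul_sum, mul_assoc] using h

theorem mem_tangentSpace_iff {k K : Type*} [Field k] [Field K] [Algebra k K] {n m : ℕ}
    (F : IntermediateField k K) (X : Set (Fin n → K)) (a : Fin n → K) (ha : a ∈ X)
    (f : Fin m → MvPolynomial (Fin n) K)
    (hf : MvPolynomial.vanishingIdeal K X = Ideal.span (Set.range f)) (v : Fin n → F) :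
    v ∈ tangentSpace F X a ↔
      ∀ i, ∑ j, (v j : K) * MvPolynomial.eval a (MvPolynomial.pderiv j (f i)) = 0 := by
  constructor
  · intro hv i
    exact hv (f i) (by rw [hf]; exact Ideal.subset_span ⟨i, rfl⟩)
  · intro hv p hp
    rw [hf] at hp
    have key : (∑ j, (v j : K) * MvPolynomial.eval a (MvPolynomial.pderiv j p) = 0) ∧
        MvPolynomial.eval a p = 0 := by
      refine Submodule.span_induction (p := fun p _ =>
        (∑ j, (v j : K) * MvPolynomial.eval a (MvPolynomial.pderiv j p) = 0) ∧
        MvPolynomial.eval a p = 0) ?_ ?_ ?_ ?_ hp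
      · rintro _ ⟨i, rfl⟩
        refine ⟨hv i, ?_⟩
        have h : f i ∈ MvPolynomial.vanishingIdeal K X := by
          rw [hf]; exact Ideal.subset_span ⟨i, rfl⟩
        simpa [MvPolynomial.aeval_eq_eval] using h a ha
      · simp
      · rintro x y _ _ ⟨h1, h2⟩ ⟨h3, h4⟩
        refine ⟨?_, by simp [h2, h4]⟩
        simp [mul_add, Finset.sum_add_distrib, h1, h3]
      · rintro r x _ ⟨h1, h2⟩
        refine ⟨?_, by simp [h2]⟩
        have h := congrArg (MvPolynomial.eval a r * ·) h1
        simp only [Finset.mul_sum, mul_zero] at h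
        rw [← h]
        refine Finset.sum_congr rfl fun j _ => ?_
        simp [h2]
        ring
    exact key.1

/-- The smooth locus of `X`: the points `a` at which the tangent space over the definition field
of `a` has the dimension of `X`. -/
def smoothLocus (k : Type*) {K : Type*} [Field k] [Fintype k] [Field K] [Algebra k K] {n : ℕ}
    (X : Set (Fin n → K)) : Set (Fin n → K) :=
  {a | a ∈ X ∧
    (Module.finrank (definitionField k a) (tangentSpace (definitionField k a) X a) : WithBot ℕ∞) =
      varietyDim X}

/-- The extending map `(x_1, …, x_n) ↦ (x_1, …, x_n, - ∑ x_i)`. -/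
def extend (R : Type*) [CommRing R] (n : ℕ) : (Fin n → R) →ₗ[R] (Fin (n + 1) → R) where
  toFun x := Fin.snoc x (-∑ i, x i)
  map_add' x y := by
    ext i
    refine Fin.lastCases ?_ (fun j => ?_) i
    · simp [Finset.sum_add_distrib, add_comm]
    · simp
  map_smul' c x := by
    ext i
    refine Fin.lastCases ?_ (fun j => ?_) i
    · simp [Finset.mul_sum]
    · simp

/-- The direct sum of two linear codes: the words `(v, w)` with `v ∈ C₁` and `w ∈ C₂`. -/
def codeSum {F : Type*} [Field F] {n m : ℕ} (C₁ : Submodule F (Fin n → F))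
    (C₂ : Submodule F (Fin m → F)) : Submodule F (Fin (n + m) → F) where
  carrier := {w | ∃ u ∈ C₁, ∃ v ∈ C₂, w = Fin.append u v}
  zero_mem' := ⟨0, C₁.zero_mem, 0, C₂.zero_mem, by
    ext i; refine Fin.addCases (fun j => ?_) (fun j => ?_) i <;> simp⟩
  add_mem' := by
    rintro _ _ ⟨u, hu, v, hv, rfl⟩ ⟨u', hu', v', hv', rfl⟩
    refine ⟨u + u', C₁.add_mem hu hu', v + v', C₂.add_mem hv hv', ?_⟩
    ext i; refine Fin.addCases (fun j => ?_) (fun j => ?_) i <;> simp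
  smul_mem' := by
    rintro c _ ⟨u, hu, v, hv, rfl⟩
    refine ⟨c • u, C₁.smul_mem c hu, c • v, C₂.smul_mem c hv, ?_⟩
    ext i; refine Fin.addCases (fun j => ?_) (fun j => ?_) i <;> simp

/-- The code `(C₁ | C₁ + C₂)`: the words `(u, u + v)` with `u ∈ C₁` and `v ∈ C₂`. -/
def uuvCode {F : Type*} [Field F] {n : ℕ} (C₁ C₂ : Submodule F (Fin n → F)) :
    Submodule F (Fin (n + n) → F) where
  carrier := {w | ∃ u ∈ C₁, ∃ v ∈ C₂, w = Fin.append u (u + v)}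
  zero_mem' := ⟨0, C₁.zero_mem, 0, C₂.zero_mem, by
    ext i; refine Fin.addCases (fun j => ?_) (fun j => ?_) i <;>
      simp [-Fin.natAdd_eq_addNat]⟩
  add_mem' := by
    rintro _ _ ⟨u, hu, v, hv, rfl⟩ ⟨u', hu', v', hv', rfl⟩
    refine ⟨u + u', C₁.add_mem hu hu', v + v', C₂.add_mem hv hv', ?_⟩
    ext i; refine Fin.addCases (fun j => ?_) (fun j => ?_) i
    · simp
    · simp [-Fin.natAdd_eq_addNat]; ring
  smul_mem' := by
    rintro c _ ⟨u, hu, v, hv, rfl⟩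
    refine ⟨c • u, C₁.smul_mem c hu, c • v, C₂.smul_mem c hv, ?_⟩
    ext i; refine Fin.addCases (fun j => ?_) (fun j => ?_) i <;>
      simp [-Fin.natAdd_eq_addNat, mul_add]

/-- The product `X × Y` in the affine space of dimension `n + m`. -/
def varietyProd {K : Type*} {n m : ℕ} (X : Set (Fin n → K)) (Y : Set (Fin m → K)) :
    Set (Fin (n + m) → K) :=
  {c | ∃ a ∈ X, ∃ b ∈ Y, c = Fin.append a b}

/-- The morphism from the affine `n`-space to the affine `s`-space given by polynomials
`g 1, …, g s` with coefficients in `k`. -/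
noncomputable def polyMap {k : Type*} (K : Type*) [Field k] [Field K] [Algebra k K] {n s : ℕ}
    (g : Fin s → MvPolynomial (Fin n) k) (x : Fin n → K) : Fin s → K :=
  fun i => MvPolynomial.aeval x (g i)

/-- The fibered product of `X` and the affine `n`-space over `g(X)`: the pairs `(a, b)` with
`a ∈ X` and `g(a) = g(b)`. -/
def fiberedProd {k K : Type*} [Field k] [Field K] [Algebra k K] {n s : ℕ}
    (X : Set (Fin n → K)) (g : Fin s → MvPolynomial (Fin n) k) : Set (Fin (n + n) → K) :=
  {c | ∃ a ∈ X, ∃ b : Fin n → K, polyMap K g a = polyMap K g b ∧ c = Fin.append a b}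

/-- The fibre of `g` through the point `a`. -/
def fibreThrough {k K : Type*} [Field k] [Field K] [Algebra k K] {n s : ℕ}
    (g : Fin s → MvPolynomial (Fin n) k) (a : Fin n → K) : Set (Fin n → K) :=
  {b | polyMap K g b = polyMap K g a}

/-- The fibre of `g` through `a` is a complete intersection: its absolute ideal is generated by
the `s` polynomials `g i - g i (a)`, and its dimension is `n - s`. -/
def IsCompleteIntersectionFibre {k K : Type*} [Field k] [Field K] [Algebra k K] {n s : ℕ}
    (g : Fin s → MvPolynomial (Fin n) k) (a : Fin n → K) : Prop :=
  MvPolynomial.vanishingIdeal K (fibreThrough g a) =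
      Ideal.span (Set.range fun i =>
        MvPolynomial.map (algebraMap k K) (g i) - MvPolynomial.C (polyMap K g a i)) ∧
    varietyDim (fibreThrough g a) + (s : WithBot ℕ∞) = (n : WithBot ℕ∞)

end TangentCodes

namespace TangentCodes

/-! Tangency is functorial: if a polynomial map `p` sends `X` into `Y`, then composition with `p`
carries `I(Y)` into `I(X)`, and by the chain rule the differential of `p` at `a` carries tangent
vectors of `X` to tangent vectors of `Y` (`IsTangent.map`). Hence generators of the ideals of the
image, the product and the fibered product are never needed.

For one inclusion, words are sums of images under differentials of maps into the target: `extend`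
itself, the slices `x ↦ (x, b)` and `y ↦ (a, y)`, and the diagonal `x ↦ (x, x)`. For the other,
project to the factors. What projections miss is supplied by explicit polynomials that vanish on the
target: the sum of all coordinates in (i), and `g i (y) - g i (x)` in (iii). -/

open MvPolynomial

variable {K : Type*} [Field K]

/-! ### Directional derivatives and the chain rule -/

/-- The derivative of a polynomial at the point `a` in the direction `v`. -/
noncomputable def dirDeriv {n : ℕ} (a v : Fin n → K) : MvPolynomial (Fin n) K →ₗ[K] K where
  toFun f := ∑ j, v j * eval a (pderiv j f)
  map_add' f g := by simp [mul_add, Finset.sum_add_distrib]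
  map_smul' c f := by
    rw [RingHom.id_apply, smul_eq_mul, Finset.mul_sum]
    refine Finset.sum_congr rfl fun j _ => ?_
    rw [Derivation.map_smul, smul_eval]
    ring

theorem dirDeriv_apply {n : ℕ} (a v : Fin n → K) (f : MvPolynomial (Fin n) K) :
    dirDeriv a v f = ∑ j, v j * eval a (pderiv j f) := rfl

@[simp]
theorem dirDeriv_C {n : ℕ} (a v : Fin n → K) (c : K) : dirDeriv a v (C c) = 0 := by
  simp [dirDeriv_apply]

@[simp]
theorem dirDeriv_X {n : ℕ} (a v : Fin n → K) (i : Fin n) : dirDeriv a v (X i) = v i := by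
  classical
  rw [dirDeriv_apply, Finset.sum_eq_single i]
  · simp
  · intro j _ hj
    simp [pderiv_X_of_ne hj.symm]
  · simp

theorem dirDeriv_mul {n : ℕ} (a v : Fin n → K) (f g : MvPolynomial (Fin n) K) :
    dirDeriv a v (f * g) = dirDeriv a v f * eval a g + eval a f * dirDeriv a v g := by
  simp only [dirDeriv_apply, Finset.mul_sum, Finset.sum_mul, ← Finset.sum_add_distrib]
  refine Finset.sum_congr rfl fun j _ => ?_
  simp only [Derivation.leibniz, smul_eq_mul, map_add, map_mul]
  ring

theorem dirDeriv_add_right {n : ℕ} (a v w : Fin n → K) (f : MvPolynomial (Fin n) K) :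
    dirDeriv a (v + w) f = dirDeriv a v f + dirDeriv a w f := by
  simp [dirDeriv_apply, add_mul, Finset.sum_add_distrib]

theorem dirDeriv_sub_right {n : ℕ} (a v w : Fin n → K) (f : MvPolynomial (Fin n) K) :
    dirDeriv a (v - w) f = dirDeriv a v f - dirDeriv a w f := by
  simp [dirDeriv_apply, sub_mul, Finset.sum_sub_distrib]

theorem eval_aeval {n m : ℕ} (a : Fin n → K) (p : Fin m → MvPolynomial (Fin n) K)
    (f : MvPolynomial (Fin m) K) :
    eval a (aeval p f) = eval (fun i => eval a (p i)) f := by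
  induction f using MvPolynomial.induction_on with
  | C c => simp [algebraMap_eq]
  | add f g hf hg => simp only [map_add, hf, hg]
  | mul_X f i hf => simp only [map_mul, hf, aeval_X, eval_X]

/-- The chain rule. -/
theorem dirDeriv_aeval {n m : ℕ} (a v : Fin n → K) (p : Fin m → MvPolynomial (Fin n) K)
    (f : MvPolynomial (Fin m) K) :
    dirDeriv a v (aeval p f) =
      dirDeriv (fun i => eval a (p i)) (fun i => dirDeriv a v (p i)) f := by
  induction f using MvPolynomial.induction_on with
  | C c => simp [algebraMap_eq]
  | add f g hf hg => simp only [map_add, hf, hg]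
  | mul_X f i hf =>
    simp only [map_mul, dirDeriv_mul, hf, eval_aeval, aeval_X, eval_X, dirDeriv_X]

/-! ### Tangent vectors and their functoriality -/

/-- The vector `v` is tangent to `X` at `a`. -/
def IsTangent {n : ℕ} (X : Set (Fin n → K)) (a v : Fin n → K) : Prop :=
  ∀ f ∈ vanishingIdeal K X, dirDeriv a v f = 0

/-- The equations live in `K`, so `F` only restricts the coordinates of `v` and the geometry can be
done over `K`. -/
theorem mem_tangentSpace {k : Type*} [Field k] [Algebra k K] {n : ℕ}
    {F : IntermediateField k K} {X : Set (Fin n → K)} {a : Fin n → K} {v : Fin n → F} :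
    v ∈ tangentSpace F X a ↔ IsTangent X a (fun i => (v i : K)) := Iff.rfl

theorem IsTangent.add {n : ℕ} {X : Set (Fin n → K)} {a v w : Fin n → K}
    (hv : IsTangent X a v) (hw : IsTangent X a w) : IsTangent X a (v + w) := fun f hf => by
  rw [dirDeriv_add_right, hv f hf, hw f hf, add_zero]

/-- The differential of a polynomial map that sends `X` to `Y` sends tangent vectors to tangent
vectors. -/
theorem IsTangent.map {n m : ℕ} {X : Set (Fin n → K)} {Y : Set (Fin m → K)} {a v : Fin n → K}
    (hv : IsTangent X a v) (p : Fin m → MvPolynomial (Fin n) K)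
    (hp : ∀ x ∈ X, (fun i => eval x (p i)) ∈ Y) {b w : Fin m → K}
    (hb : ∀ i, eval a (p i) = b i) (hw : ∀ i, dirDeriv a v (p i) = w i) :
    IsTangent Y b w := fun f hf => by
  obtain rfl : _ = b := funext hb
  obtain rfl : _ = w := funext hw
  -- The derivative of `f` becomes that of the composite of `f` with `p`, which vanishes on `X`.
  rw [← dirDeriv_aeval]
  refine hv _ fun x hx => ?_
  rw [aeval_eq_eval, eval_aeval]
  exact hf _ (hp x hx)

theorem append_coe {k : Type*} [Field k] [Algebra k K] {F : IntermediateField k K} {n m : ℕ}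
    (u : Fin n → F) (v : Fin m → F) :
    (fun i => ((Fin.append u v i : F) : K)) = Fin.append (fun i => (u i : K)) fun i => (v i : K) := by
  ext i
  refine Fin.addCases (fun j => ?_) (fun j => ?_) i <;> simp [-Fin.natAdd_eq_addNat]

/-- Differential of the slice `y ↦ (a, y)`: the constant block contributes 0. `Z` is left general to
serve both the product and the fibered product. -/
theorem isTangent_append_right {n m : ℕ} {Y : Set (Fin m → K)} {Z : Set (Fin (n + m) → K)}
    {a : Fin n → K} {b v : Fin m → K} (h : ∀ y ∈ Y, Fin.append a y ∈ Z) (hv : IsTangent Y b v) :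
    IsTangent Z (Fin.append a b) (Fin.append 0 v) := by
  refine hv.map (Fin.append (fun i => C (a i)) X) (fun y hy => ?_)
    (fun i => Fin.addCases (fun j => ?_) (fun j => ?_) i)
    (fun i => Fin.addCases (fun j => ?_) (fun j => ?_) i) <;>
    try simp [-Fin.natAdd_eq_addNat]
  convert h y hy using 1
  ext i
  refine Fin.addCases (fun j => ?_) (fun j => ?_) i <;> simp [-Fin.natAdd_eq_addNat]

theorem isTangent_append_left {n m : ℕ} {X : Set (Fin n → K)} {Z : Set (Fin (n + m) → K)}
    {a u : Fin n → K} {b : Fin m → K} (h : ∀ x ∈ X, Fin.append x b ∈ Z) (hu : IsTangent X a u) :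
    IsTangent Z (Fin.append a b) (Fin.append u 0) := by
  refine hu.map (Fin.append MvPolynomial.X fun i => C (b i)) (fun x hx => ?_)
    (fun i => Fin.addCases (fun j => ?_) (fun j => ?_) i)
    (fun i => Fin.addCases (fun j => ?_) (fun j => ?_) i) <;>
    try simp [-Fin.natAdd_eq_addNat]
  convert h x hx using 1
  ext i
  refine Fin.addCases (fun j => ?_) (fun j => ?_) i <;> simp [-Fin.natAdd_eq_addNat]

/-- Differential of the diagonal. It stands in for the slice `x ↦ (x, b)`, which need not stay
inside a fibered product. -/
theorem isTangent_append_diag {n : ℕ} {X : Set (Fin n → K)} {Z : Set (Fin (n + n) → K)}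
    {a u : Fin n → K} (h : ∀ x ∈ X, Fin.append x x ∈ Z) (hu : IsTangent X a u) :
    IsTangent Z (Fin.append a a) (Fin.append u u) := by
  refine hu.map (Fin.append MvPolynomial.X MvPolynomial.X) (fun x hx => ?_)
    (fun i => Fin.addCases (fun j => ?_) (fun j => ?_) i)
    (fun i => Fin.addCases (fun j => ?_) (fun j => ?_) i) <;>
    try simp [-Fin.natAdd_eq_addNat]
  convert h x hx using 1
  ext i
  refine Fin.addCases (fun j => ?_) (fun j => ?_) i <;> simp [-Fin.natAdd_eq_addNat]

/-- A selection of coordinates is linear, hence its own differential; with suitable `e` it is the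
projection to a factor. -/
theorem isTangent_comp {n m : ℕ} {X : Set (Fin n → K)} {Z : Set (Fin m → K)} (e : Fin n → Fin m)
    (h : ∀ z ∈ Z, (fun i => z (e i)) ∈ X) {a : Fin n → K} {c w : Fin m → K}
    (hc : ∀ i, c (e i) = a i) (hw : IsTangent Z c w) : IsTangent X a fun i => w (e i) :=
  hw.map (fun i => MvPolynomial.X (e i)) (fun z hz => by simpa using h z hz)
    (fun i => by simp [hc]) fun i => by simp

/-! ### The three equalities of codes, over any intermediate field -/

section

variable {k : Type*} [Field k] [Algebra k K] (F : IntermediateField k K)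

theorem extend_apply_castSucc {R : Type*} [CommRing R] {n : ℕ} (x : Fin n → R) (i : Fin n) :
    extend R n x i.castSucc = x i := by
  simp [extend]

theorem extend_apply_last {R : Type*} [CommRing R] {n : ℕ} (x : Fin n → R) :
    extend R n x (Fin.last n) = -∑ i, x i := by
  simp [extend]

theorem map_extend_tangentSpace {n : ℕ} (X : Set (Fin n → K)) (a : Fin n → K) :
    (tangentSpace F X a).map (extend F n) =
      tangentSpace F (extend K n '' X) (extend K n a) := by
  ext w
  constructor
  · rintro ⟨v, hv, rfl⟩
    refine (mem_tangentSpace.1 hv).map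
      (extend (MvPolynomial (Fin n) K) n MvPolynomial.X) ?_
      (fun i => Fin.lastCases ?_ (fun j => ?_) i) (fun i => Fin.lastCases ?_ (fun j => ?_) i)
    · refine fun x hx => ⟨x, hx, funext fun i => ?_⟩
      refine Fin.lastCases ?_ (fun j => ?_) i <;>
        simp [extend_apply_castSucc, extend_apply_last]
    all_goals simp [extend_apply_castSucc, extend_apply_last]
  · intro hw
    have hlast : w (Fin.last n) = -∑ i : Fin n, w i.castSucc := by
      -- The sum of all coordinates vanishes on the image and, being linear, is its own derivative;
      -- so it also vanishes on `w`.
      have h := mem_tangentSpace.1 hw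
        (MvPolynomial.X (Fin.last n) + ∑ i : Fin n, MvPolynomial.X i.castSucc) (by
          rintro _ ⟨x, -, rfl⟩
          simp [extend_apply_castSucc, extend_apply_last])
      rw [map_add, map_sum] at h
      simp only [dirDeriv_X] at h
      apply Subtype.ext
      push_cast
      exact eq_neg_of_add_eq_zero_left h
    refine ⟨fun i => w i.castSucc, ?_, ?_⟩
    · exact isTangent_comp Fin.castSucc (by
        rintro _ ⟨x, hx, rfl⟩
        convert hx using 1
        ext i
        simp [extend_apply_castSucc]) (fun i => by simp [extend_apply_castSucc]) (mem_tangentSpace.1 hw)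
    · ext i
      refine Fin.lastCases ?_ (fun j => ?_) i
      · rw [extend_apply_last, hlast]
      · rw [extend_apply_castSucc]

theorem codeSum_tangentSpace {n m : ℕ} {X : Set (Fin n → K)} {Y : Set (Fin m → K)}
    {a : Fin n → K} {b : Fin m → K} (ha : a ∈ X) (hb : b ∈ Y) :
    codeSum (tangentSpace F X a) (tangentSpace F Y b) =
      tangentSpace F (varietyProd X Y) (Fin.append a b) := by
  ext w
  constructor
  · rintro ⟨u, hu, v, hv, rfl⟩
    rw [mem_tangentSpace, append_coe]
    -- Split `(u, v) = (u, 0) + (0, v)`.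
    have h := (isTangent_append_left (Z := varietyProd X Y) (b := b)
      (fun x hx => ⟨x, hx, b, hb, rfl⟩) (mem_tangentSpace.1 hu)).add
      (isTangent_append_right (a := a) (fun y hy => ⟨a, ha, y, hy, rfl⟩) (mem_tangentSpace.1 hv))
    convert h using 1
    ext i
    refine Fin.addCases (fun j => ?_) (fun j => ?_) i <;> simp [-Fin.natAdd_eq_addNat]
  · intro hw
    refine ⟨fun i => w (Fin.castAdd m i), ?_, fun i => w (Fin.natAdd n i), ?_,
      (Fin.append_castAdd_natAdd).symm⟩
    · exact isTangent_comp (Fin.castAdd m) (by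
        rintro _ ⟨x, hx, y, -, rfl⟩
        convert hx using 1
        ext i
        simp) (fun i => by simp) (mem_tangentSpace.1 hw)
    · exact isTangent_comp (Fin.natAdd n) (by
        rintro _ ⟨x, -, y, hy, rfl⟩
        convert hy using 1
        ext i
        simp) (fun i => by simp) (mem_tangentSpace.1 hw)

theorem uuvCode_tangentSpace {n s : ℕ} {X : Set (Fin n → K)} (g : Fin s → MvPolynomial (Fin n) k)
    {a : Fin n → K} (ha : a ∈ X)
    (hg : vanishingIdeal K (fibreThrough g a) = Ideal.span (Set.range fun i =>
      MvPolynomial.map (algebraMap k K) (g i) - C (polyMap K g a i))) :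
    uuvCode (tangentSpace F X a) (tangentSpace F (fibreThrough g a) a) =
      tangentSpace F (fiberedProd X g) (Fin.append a a) := by
  ext w
  constructor
  · rintro ⟨u, hu, v, hv, rfl⟩
    rw [mem_tangentSpace, append_coe]
    -- Split `(u, u + v) = (u, u) + (0, v)`: the diagonal maps `X` into the fibered product, and `y
    -- ↦ (a, y)` maps the fibre into it.
    have h := (isTangent_append_diag (Z := fiberedProd X g)
      (fun x hx => ⟨x, hx, x, rfl, rfl⟩) (mem_tangentSpace.1 hu)).add
      (isTangent_append_right (a := a) (fun y hy => ⟨a, ha, y, hy.symm, rfl⟩)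
        (mem_tangentSpace.1 hv))
    convert h using 1
    ext i
    refine Fin.addCases (fun j => ?_) (fun j => ?_) i <;> simp [-Fin.natAdd_eq_addNat]
  · intro hw
    refine ⟨fun i => w (Fin.castAdd n i), ?_,
      fun i => w (Fin.natAdd n i) - w (Fin.castAdd n i), ?_, ?_⟩
    · exact isTangent_comp (Fin.castAdd n) (by
        rintro _ ⟨x, hx, y, -, rfl⟩
        convert hx using 1
        ext i
        simp) (fun i => by simp) (mem_tangentSpace.1 hw)
    -- Here the complete intersection matters: since the `g i - g i (a)` generate the ideal of the
    -- fibre, tangency need only be tested on them.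
    · refine (mem_tangentSpace_iff F (fibreThrough g a) a rfl _ hg _).2 fun i => ?_
      set G := MvPolynomial.map (algebraMap k K) (g i) with hG
      have hGeval : ∀ x, eval x G = polyMap K g x i := fun x => by
        rw [hG, eval_map, polyMap, aeval_def]
      -- With `w = (w₁, w₂)`, the derivative of `g i (y) - g i (x)` at `(a, a)` is that of `g i` at
      -- `a` along `w₂ - w₁`, because both blocks have the same base point.
      have h := mem_tangentSpace.1 hw
        (aeval (fun j => MvPolynomial.X (Fin.natAdd n j)) G -
          aeval (fun j => MvPolynomial.X (Fin.castAdd n j)) G) (by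
          rintro _ ⟨x, -, y, hxy, rfl⟩
          rw [aeval_eq_eval, map_sub, eval_aeval, eval_aeval]
          simp [-Fin.natAdd_eq_addNat, hGeval, hxy])
      rw [map_sub, dirDeriv_aeval, dirDeriv_aeval] at h
      simp only [eval_X, dirDeriv_X, Fin.append_left, Fin.append_right] at h
      rw [← dirDeriv_sub_right] at h
      change dirDeriv a _ (G - C _) = 0
      rw [map_sub, dirDeriv_C, sub_zero]
      exact h
    · ext i
      refine Fin.addCases (fun j => ?_) (fun j => ?_) i <;> simp [-Fin.natAdd_eq_addNat]

end

end TangentCodes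

theorem proposition6p5 {k K : Type*} [Field k] [Fintype k] [Field K] [Algebra k K]
    [IsAlgClosure k K] :
    (∀ (n : ℕ) (X : Set (Fin n → K)),
      TangentCodes.IsIrreducibleVariety X → TangentCodes.IsDefinedOver k X →
      ∀ a ∈ TangentCodes.smoothLocus k X,
        (TangentCodes.tangentSpace (TangentCodes.definitionField k a) X a).map
            (TangentCodes.extend (TangentCodes.definitionField k a) n) =
          TangentCodes.tangentSpace (TangentCodes.definitionField k a)
            (TangentCodes.extend K n '' X) (TangentCodes.extend K n a)) ∧
    (∀ (n m : ℕ) (X : Set (Fin n → K)) (Y : Set (Fin m → K)),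
      TangentCodes.IsIrreducibleVariety X → TangentCodes.IsDefinedOver k X →
      TangentCodes.IsIrreducibleVariety Y → TangentCodes.IsDefinedOver k Y →
      ∀ a ∈ TangentCodes.smoothLocus k X, ∀ b ∈ TangentCodes.smoothLocus k Y,
        TangentCodes.codeSum
            (TangentCodes.tangentSpace (TangentCodes.definitionField k (Fin.append a b)) X a)
            (TangentCodes.tangentSpace (TangentCodes.definitionField k (Fin.append a b)) Y b) =
          TangentCodes.tangentSpace (TangentCodes.definitionField k (Fin.append a b))
            (TangentCodes.varietyProd X Y) (Fin.append a b)) ∧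
    (∀ (n s : ℕ) (X : Set (Fin n → K)) (g : Fin s → MvPolynomial (Fin n) k),
      TangentCodes.IsIrreducibleVariety X → TangentCodes.IsDefinedOver k X →
      ∀ a ∈ TangentCodes.smoothLocus k X,
        TangentCodes.IsIrreducibleVariety (TangentCodes.fibreThrough g a) →
        TangentCodes.IsDefinedOver k (TangentCodes.fibreThrough g a) →
        TangentCodes.IsCompleteIntersectionFibre g a →
        a ∈ TangentCodes.smoothLocus k (TangentCodes.fibreThrough g a) →
        TangentCodes.uuvCode
            (TangentCodes.tangentSpace (TangentCodes.definitionField k a) X a)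
            (TangentCodes.tangentSpace (TangentCodes.definitionField k a)
              (TangentCodes.fibreThrough g a) a) =
          TangentCodes.tangentSpace (TangentCodes.definitionField k a)
            (TangentCodes.fiberedProd X g) (Fin.append a a)) := by
  refine ⟨fun n X _ _ a _ => ?_, fun n m X Y _ _ _ _ a ha b hb => ?_,
    fun n s X g _ _ a ha _ _ hg _ => ?_⟩
  · exact TangentCodes.map_extend_tangentSpace _ X a
  · exact TangentCodes.codeSum_tangentSpace _ ha.1 hb.1
  · exact TangentCodes.uuvCode_tangentSpace _ g ha.1 hg.1
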